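/- Let $\mathbb{F}_q$ be a finite field with $q$ elements, let $n\ge 1$, and let $\ell\in\mathbb{N}$ with $2\le \ell<q$. Call a set $S\subset\mathbb{F}_q^n$ a BRK-type set of degree $\ell$ if there is a nonzero homogeneous polynomial $g\in\mathbb{F}_q[s_1,\dots,s_{n-1}]$ of degree $\ell$ such that for every $\rho\in\mathbb{F}_q$ there exist a point $a=a(\rho)\in\mathbb{F}_q^n$ and a polynomial $g_\rho\in\mathbb{F}_q[s_1,\dots,s_{n-1}]$ whose homogeneous part of highest degree is $g$, with \[ \{a+\rho(\lambda,g_\rho(\lambda)) : \lambda\in\mathbb{F}_q^{n-1}\}\subset S. \] If $S\subset\mathbb{F}_q^n$ is a BRK-type set of degree $\ell$, then \[ |S|\ge \frac{(q-1)^n}{(\ell+1-2\ell/q)^n}. \] -/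

import Mathlib

open MvPolynomial

/-- The homogeneous part of highest degree of a polynomial `p` (it is `0` only for `p = 0`). -/
noncomputable def topForm {σ F : Type*} [Field F] (p : MvPolynomial σ F) : MvPolynomial σ F :=
  homogeneousComponent p.totalDegree p

/-- The hypersurface `{a + ρ (t, h(t)) : t ∈ F ^ m}` in `F ^ (m + 1)`. The last coordinate of
`Fin.snoc t c` is `c`, the others are those of `t`. -/
def dilatedGraph {F : Type*} [Field F] {m : ℕ} (a : Fin (m + 1) → F) (ρ : F)
    (h : MvPolynomial (Fin m) F) : Set (Fin (m + 1) → F) :=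
  Set.range fun t : Fin m → F => a + ρ • (Fin.snoc t (eval t h) : Fin (m + 1) → F)

/-- `S ⊆ F ^ n`, with `n = m + 1`, is a BRK-type set of degree `ℓ ≥ 2`: for one (nonzero)
homogeneous polynomial `g` of degree `ℓ` in `n - 1` variables, and every `ρ`, the set `S` contains
`{a + ρ (t, h(t)) : t ∈ F ^ (n - 1)}` for some point `a` and some polynomial `h` whose homogeneous
part of highest degree is `g`, both of which may depend on `ρ`. -/
def IsBRKType {F : Type*} [Field F] {m : ℕ} (ℓ : ℕ) (S : Set (Fin (m + 1) → F)) : Prop :=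
  2 ≤ ℓ ∧ ∃ g : MvPolynomial (Fin m) F, g ≠ 0 ∧ g.IsHomogeneous ℓ ∧
    ∀ ρ : F, ∃ (a : Fin (m + 1) → F) (h : MvPolynomial (Fin m) F),
      topForm h = g ∧ dilatedGraph a ρ h ⊆ S

/-!
The proof is the method of multiplicities. Write `n = m + 1`, and say that `p` vanishes to order `M`
at `s` when `p` lies in the `M`-th power of the maximal ideal `ker (eval s)`. If `S` is small, then
counting coefficients gives a nonzero `p` in `n` variables, of degree `< N`, vanishing to order `M`
on `S` (`exists_ne_zero_forall_mem_ker_eval_pow`).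

Fix `ρ`, with its point `a` and polynomial `h`, and expand `p` around the generic point
`A(t) = a + ρ (t, h(t))` as `p(A(t) + y) = ∑ c_α(t) y ^ α`. The coefficient `c_α` vanishes to order
`M - |α|` at every `t ∈ F ^ m`, and has degree at most `ℓ (deg p - |α|)`. By the Schwartz–Zippel
lemma with multiplicities (`eq_zero_of_forall_mem_ker_eval_pow`) this forces `c_α = 0` for `|α| < k`,
if the parameters are right: `p` vanishes to order `k` along the whole hypersurface, as a polynomial
identity (`expandAround_mem_idealOfVars_pow`).

The point `a` and the lower terms of `h` depend on `ρ`, and are removed by passing to leading terms.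
Give the first `m` variables weight `1` and the last one weight `ℓ`, and let `Q` be the part of `p`
of the highest weight. Take `y = (R - ρ) (t, g(t))` with a new variable `R`: as the leading part of
`A(t) + y` is `R (t, g(t))`, the highest weighted part in `t` of `p(A(t) + y)` is
`G = Q(R t, R g(t))` (`coeff_weightedSubst_expandAround`). It does not depend on `ρ`, and it is
divisible by `(R - ρ) ^ k`, for each `ρ`. Its degree in `R` is less than `N`, so `G = 0` once
`N ≤ q k`. But `G` determines `Q`: the degree in `R` and the weight of a monomial determine its
exponent in the last variable, because `ℓ ≠ 1`. So `Q = 0`, a contradiction.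

The parameters are `k = j q`, `N = j q (q - 1)` and `M = j ((ℓ + 1) q - 2 ℓ)`; the bound follows as
`j → ∞`.
-/

/-! ### Powers of ideals and divisibility by powers of `X - C a` -/

/-- A sharpening by one of `Ideal.sup_pow_add_le_pow_sup_pow`. -/
theorem Ideal.sup_pow_le_pow_sup_pow {R : Type*} [CommRing R] (I J : Ideal R) {r n m : ℕ}
    (h : n + m ≤ r + 1) : (I ⊔ J) ^ r ≤ I ^ n ⊔ J ^ m := by
  rw [← Ideal.add_eq_sup, ← Ideal.add_eq_sup, add_pow, Ideal.sum_eq_sup]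
  refine Finset.sup_le fun i _ => ?_
  by_cases hn : n ≤ i
  · exact Ideal.mul_le_left.trans (Ideal.mul_le_left.trans
      ((Ideal.pow_le_pow_right hn).trans le_sup_left))
  · exact Ideal.mul_le_left.trans (Ideal.mul_le_right.trans
      ((Ideal.pow_le_pow_right (by lia)).trans le_sup_right))

theorem Polynomial.eq_zero_of_forall_X_sub_C_pow_dvd {R : Type*} [CommRing R] (A : Finset R)
    (hA : ∀ a ∈ A, ∀ b ∈ A, a ≠ b → IsUnit (a - b)) (k : ℕ) (p : Polynomial R)
    (hp : ∀ a ∈ A, (Polynomial.X - Polynomial.C a) ^ k ∣ p) (hd : p.natDegree < A.card * k) :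
    p = 0 := by
  nontriviality R
  by_contra h0
  have hm : (∏ a ∈ A, (Polynomial.X - Polynomial.C a) ^ k).Monic :=
    Polynomial.monic_prod_of_monic _ _ fun a _ => (Polynomial.monic_X_sub_C a).pow k
  refine hm.not_dvd_of_natDegree_lt h0 ?_ (Finset.prod_dvd_of_coprime ?_ hp)
  · rw [Polynomial.natDegree_prod_of_monic _ _
      fun a _ => (Polynomial.monic_X_sub_C a).pow k]
    simpa [(Polynomial.monic_X_sub_C _).natDegree_pow] using hd
  · intro a ha b hb hab
    exact (Polynomial.isCoprime_X_sub_C_of_isUnit_sub (hA a ha b hb hab)).pow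

/-- A nonzero polynomial over an `F`-algebra has at most as many zeros in the field `F`, counted with
multiplicity, as its degree. The coefficient ring may have zero divisors. -/
theorem Polynomial.eq_zero_of_forall_X_sub_C_pow_dvd_algebraMap {F R : Type*} [Field F] [CommRing R]
    [Nontrivial R] [Algebra F R] (A : Finset F) (k : ℕ) (p : Polynomial R)
    (hp : ∀ a ∈ A, (Polynomial.X - Polynomial.C (algebraMap F R a)) ^ k ∣ p)
    (hd : p.natDegree < A.card * k) : p = 0 := by
  classical
  refine Polynomial.eq_zero_of_forall_X_sub_C_pow_dvd (A.image (algebraMap F R)) ?_ k p ?_ ?_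
  · simp only [Finset.mem_image]
    rintro _ ⟨a, -, rfl⟩ _ ⟨b, -, rfl⟩ hab
    rw [← map_sub]
    exact (IsUnit.mk0 _ (sub_ne_zero.2 fun h => hab (congrArg _ h))).map _
  · simpa using hp
  · rwa [Finset.card_image_of_injective _ (algebraMap F R).injective]

theorem Polynomial.X_sub_C_pow_dvd_map_mk {R : Type*} [CommRing R] {J : Ideal R} {c : R}
    {f : Polynomial R} {n a : ℕ}
    (hf : f ∈ Ideal.span {Polynomial.X - Polynomial.C c} ^ n ⊔ J.map Polynomial.C ^ a) :
    (Polynomial.X - Polynomial.C (Ideal.Quotient.mk (J ^ a) c)) ^ n ∣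
      f.map (Ideal.Quotient.mk (J ^ a)) := by
  obtain ⟨u, hu, v, hv, rfl⟩ := Submodule.mem_sup.1 hf
  rw [Ideal.span_singleton_pow] at hu
  obtain ⟨w, rfl⟩ := Ideal.mem_span_singleton.1 hu
  rw [← Ideal.map_pow, Ideal.mem_map_C_iff] at hv
  have hv0 : v.map (Ideal.Quotient.mk (J ^ a)) = 0 := by
    ext i
    simpa using Ideal.Quotient.eq_zero_iff_mem.2 (hv i)
  simp [hv0]

/-! ### The Schwartz–Zippel lemma with multiplicities -/

theorem MvPolynomial.map_finSuccEquiv_ker_eval_cons_le {R : Type*} [CommRing R] {m : ℕ} (c : R)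
    (x : Fin m → R) :
    (RingHom.ker (eval (Fin.cons c x : Fin (m + 1) → R))).map
        (finSuccEquiv R m : MvPolynomial (Fin (m + 1)) R →+* _) ≤
      Ideal.span {Polynomial.X - Polynomial.C (C c)} ⊔
        (RingHom.ker (eval x)).map Polynomial.C := by
  refine Ideal.map_le_iff_le_comap.2 fun p hp => ?_
  rw [RingHom.mem_ker, eval_eq_eval_mv_eval', ← eval_C (f := x) c, Polynomial.eval_map_apply] at hp
  obtain ⟨g, hg⟩ := Polynomial.X_sub_C_dvd_sub_C_eval (a := C c) (p := finSuccEquiv R m p)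
  rw [sub_eq_iff_eq_add] at hg
  rw [Ideal.mem_comap, RingHom.coe_coe, hg]
  refine add_mem (Ideal.mem_sup_left (Ideal.mul_mem_right _ _ (Ideal.mem_span_singleton_self _)))
    (Ideal.mem_sup_right (Ideal.mem_map_of_mem _ hp))

/-- **Schwartz–Zippel lemma with multiplicities**, on the full grid: a polynomial that vanishes to
order `r` at all points of `F ^ m`, and has degree less than `r q`, is zero. By induction on `m`: if
`t` is the degree in the first variable, then the leading coefficient in that variable vanishes to
order `r'` at all points of `F ^ (m - 1)`, where `r'` is the least number with `q (r - r') ≤ t`. -/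
theorem MvPolynomial.eq_zero_of_forall_mem_ker_eval_pow {F : Type*} [Field F] [Fintype F] {m : ℕ}
    (p : MvPolynomial (Fin m) F) (r : ℕ) (hp : ∀ x, p ∈ RingHom.ker (eval x) ^ r)
    (hd : p.totalDegree < r * Fintype.card F) : p = 0 := by
  induction m generalizing r with
  | zero =>
    have h := hp 0
    obtain ⟨c, rfl⟩ := C_surjective (Fin 0) p
    have hr : r ≠ 0 := by rintro rfl; simp at hd
    simpa using Ideal.pow_le_self hr h
  | succ m ih =>
    set f := finSuccEquiv F m p with hf
    by_contra hp0
    have hf0 : f ≠ 0 := by simpa [hf] using hp0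
    set t := f.natDegree with ht
    have hlead : f.coeff t ≠ 0 := by simpa [ht] using hf0
    have htd := totalDegree_coeff_finSuccEquiv_add_le p t hlead
    -- Modulo `J ^ (a + 1)`, where `J` is the ideal of `x`, the polynomial `f` is divisible by
    -- `(X - c) ^ (r - a)` for all `c ∈ F`, so it vanishes if its degree is less than `q (r - a)`.
    have key : ∀ x a, t < Fintype.card F * (r - a) →
        f.coeff t ∈ RingHom.ker (eval x) ^ (a + 1) := by
      intro x a hta
      set J := RingHom.ker (eval (R := F) x) with hJ
      by_cases hJt : J ^ (a + 1) = ⊤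
      · simp [hJt]
      have : Nontrivial (MvPolynomial (Fin m) F ⧸ J ^ (a + 1)) := Ideal.Quotient.nontrivial_iff.2 hJt
      have hz : f.map (Ideal.Quotient.mk (J ^ (a + 1))) = 0 := by
        refine Polynomial.eq_zero_of_forall_X_sub_C_pow_dvd_algebraMap (Finset.univ : Finset F) (r - a)
          _ (fun c _ => ?_) (Polynomial.natDegree_map_le.trans_lt (by simpa using hta))
        have har : (r - a) + (a + 1) ≤ r + 1 := by
          have : r - a ≠ 0 := by rintro h; simp [h] at hta
          lia
        have h1 := Ideal.mem_map_of_mem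
          (finSuccEquiv F m : MvPolynomial (Fin (m + 1)) F →+* Polynomial (MvPolynomial (Fin m) F))
          (hp (Fin.cons c x))
        rw [Ideal.map_pow] at h1
        have h2 := Ideal.sup_pow_le_pow_sup_pow _ _ har
          (Ideal.pow_right_mono (map_finSuccEquiv_ker_eval_cons_le c x) r h1)
        exact Polynomial.X_sub_C_pow_dvd_map_mk h2
      have := congrArg (fun g => g.coeff t) hz
      simpa [Ideal.Quotient.eq_zero_iff_mem] using this
    have hr' : ∃ r', Fintype.card F * (r - r') ≤ t := ⟨r, by simp⟩
    classical
    have hmin := Nat.find_spec hr'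
    set r' := Nat.find hr' with hr'def
    refine hlead (ih (f.coeff t) r' (fun x => ?_) ?_)
    · rcases Nat.eq_zero_or_pos r' with h0 | h0
      · simp [h0]
      · have := Nat.find_min hr' (m := r' - 1) (by lia)
        have h := key x (r' - 1) (by lia)
        rwa [Nat.sub_add_cancel h0] at h
    · have : r * Fintype.card F ≤ t + r' * Fintype.card F := by
        calc r * Fintype.card F ≤ ((r - r') + r') * Fintype.card F := by gcongr; lia
          _ ≤ _ := by rw [add_mul]; gcongr; rwa [mul_comm]
      lia

/-! ### A polynomial of low degree vanishing to high order on a small set -/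

theorem Finsupp.natCard_degree_lt (m N : ℕ) :
    Nat.card {α : Fin (m + 1) →₀ ℕ // α.degree < N} = (N + m).choose (m + 1) := by
  classical
  have h : ∀ α : Fin (m + 1) →₀ ℕ, α.degree < N ↔
      α ∈ (Finset.range N).biUnion fun i => (Finset.univ : Finset (Fin (m + 1))).finsuppAntidiag i := by
    intro α
    simp [Finsupp.degree_eq_sum]
  rw [Nat.card_congr (Equiv.subtypeEquivRight h), Nat.card_eq_fintype_card, Fintype.card_coe,
    Finset.card_biUnion]
  · cases N with
    | zero => simp
    | succ N =>
      rw [add_right_comm, ← Nat.sum_range_add_choose]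
      refine Finset.sum_congr rfl fun i _ => ?_
      rw [Finset.card_finsuppAntidiag_nat_eq_choose, Finset.card_univ, Fintype.card_fin,
        add_right_comm, Nat.add_sub_cancel, add_comm, Nat.choose_symm_add]
  · intro i _ j _ hij
    refine Finset.disjoint_left.2 fun α hi hj => hij ?_
    simp only [Finset.mem_finsuppAntidiag] at hi hj
    exact hi.1.symm.trans hj.1

theorem MvPolynomial.mem_ker_eval_pow_of_aeval_X_add_C_mem {σ R : Type*} [CommRing R] (s : σ → R)
    (p : MvPolynomial σ R) (M : ℕ)
    (h : aeval (fun i => X i + C (s i)) p ∈ idealOfVars σ R ^ M) :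
    p ∈ RingHom.ker (eval s) ^ M := by
  have h1 := Ideal.mem_map_of_mem (aeval (R := R) fun i => (X i - C (s i) : MvPolynomial σ R)) h
  rw [Ideal.map_pow, ← AlgHom.comp_apply] at h1
  have h2 : (aeval (R := R) fun i => (X i - C (s i) : MvPolynomial σ R)).comp
      (aeval fun i => X i + C (s i)) = AlgHom.id R (MvPolynomial σ R) := by
    ext i
    simp [algHom_C]
  rw [h2, AlgHom.id_apply] at h1
  refine Ideal.pow_right_mono ?_ M h1
  rw [Ideal.map_span, Ideal.span_le]
  rintro _ ⟨_, ⟨i, rfl⟩, rfl⟩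
  simp

theorem MvPolynomial.exists_ne_zero_forall_mem_ker_eval_pow {F : Type*} [Field F] {m : ℕ}
    (S : Set (Fin (m + 1) → F)) (hS : S.Finite) (M N : ℕ)
    (h : S.ncard * (M + m).choose (m + 1) < (N + m).choose (m + 1)) :
    ∃ p : MvPolynomial (Fin (m + 1)) F, p ≠ 0 ∧ (∀ α ∈ p.support, α.degree < N) ∧
      ∀ s ∈ S, p ∈ RingHom.ker (eval s) ^ M := by
  have := hS.to_subtype
  have hfin (K : ℕ) : Finite {α : Fin (m + 1) →₀ ℕ | α.degree < K} :=
    Finsupp.finite_of_degree_lt K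
  have hb := basisRestrictSupport F {α : Fin (m + 1) →₀ ℕ | α.degree < N}
  have : FiniteDimensional F (restrictSupport F {α : Fin (m + 1) →₀ ℕ | α.degree < N}) :=
    Module.Finite.of_basis hb
  let L : restrictSupport F {α : Fin (m + 1) →₀ ℕ | α.degree < N} →ₗ[F]
      (S × {α : Fin (m + 1) →₀ ℕ | α.degree < M} → F) :=
    (LinearMap.pi fun sα => lcoeff F (sα.2 : Fin (m + 1) →₀ ℕ) ∘ₗ
      (aeval fun i => X i + C ((sα.1 : Fin (m + 1) → F) i)).toLinearMap) ∘ₗ Submodule.subtype _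
  have hL : LinearMap.ker L ≠ ⊥ := by
    refine LinearMap.ker_ne_bot_of_finrank_lt ?_
    have := Fintype.ofFinite (S × {α : Fin (m + 1) →₀ ℕ | α.degree < M})
    rw [Module.finrank_fintype_fun_eq_card, ← Nat.card_eq_fintype_card, Nat.card_prod,
      Module.finrank_eq_nat_card_basis hb]
    exact (Finsupp.natCard_degree_lt m N).symm ▸ (Finsupp.natCard_degree_lt m M).symm ▸ h
  obtain ⟨p, hp, hp0⟩ := (Submodule.ne_bot_iff _).1 hL
  refine ⟨p, by simpa using hp0, fun α hα => ((mem_restrictSupport_iff F).1 p.2) hα, fun s hs => ?_⟩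
  refine mem_ker_eval_pow_of_aeval_X_add_C_mem s _ M ((mem_pow_idealOfVars_iff' _ _).2 ?_)
  intro α hα
  exact congrFun (LinearMap.mem_ker.1 hp) (⟨s, hs⟩, ⟨α, hα⟩)

/-- Up to the factor `(m + 1)!`, the binomial coefficients `(j A + m).choose (m + 1)` and
`(j c + m).choose (m + 1)` are asymptotic to `(j A) ^ (m + 1)` and `(j c) ^ (m + 1)`. -/
theorem pow_le_mul_pow_of_forall_choose_le {A c K m : ℕ}
    (h : ∀ j : ℕ, 0 < j → (j * A + m).choose (m + 1) ≤ K * (j * c + m).choose (m + 1)) :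
    A ^ (m + 1) ≤ K * c ^ (m + 1) := by
  have hj : ∀ j : ℕ, 0 < j → (A : ℝ) ^ (m + 1) ≤ K * (c + (m + 1) * (1 / j)) ^ (m + 1) := by
    intro j hj
    have h1 : (j * A) ^ (m + 1) ≤ K * (j * c + (m + 1)) ^ (m + 1) := by
      calc (j * A) ^ (m + 1) ≤ (j * A).ascFactorial (m + 1) := Nat.pow_succ_le_ascFactorial _ _
        _ = (m + 1).factorial * (j * A + m).choose (m + 1) := by
          rw [Nat.ascFactorial_eq_factorial_mul_choose']; rfl
        _ ≤ (m + 1).factorial * (K * (j * c + m).choose (m + 1)) := by gcongr; exact h j hj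
        _ = K * (j * c).ascFactorial (m + 1) := by
          rw [Nat.ascFactorial_eq_factorial_mul_choose', mul_left_comm]; rfl
        _ ≤ K * (j * c + 1).ascFactorial (m + 1) := by
          gcongr; exact Nat.le_succ _
        _ ≤ _ := by gcongr; exact Nat.ascFactorial_le_pow_add _ _
    have hj0 : (0 : ℝ) < j := by exact_mod_cast hj
    have h2 : ((j : ℝ) * A) ^ (m + 1) ≤ K * (j * c + (m + 1)) ^ (m + 1) := by exact_mod_cast h1
    have h3 : (j : ℝ) * c + (m + 1) = j * (c + (m + 1) * (1 / j)) := by field_simp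
    rw [h3, mul_pow, mul_pow, mul_left_comm] at h2
    exact le_of_mul_le_mul_left h2 (by positivity)
  have hlim : Filter.Tendsto (fun j : ℕ => (K : ℝ) * (c + (m + 1) * (1 / j)) ^ (m + 1)) Filter.atTop
      (nhds (K * (c + (m + 1) * 0) ^ (m + 1))) :=
    (((tendsto_one_div_atTop_nhds_zero_nat.const_mul _).const_add _).pow _).const_mul _
  have := ge_of_tendsto hlim (Filter.eventually_atTop.2 ⟨1, fun j hj' => hj j hj'⟩)
  simp only [mul_zero, add_zero] at this
  exact_mod_cast this

/-! ### Expansion around a generic point of a parametrized hypersurface -/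

/-- The expansion `p(A + y)` of a polynomial `p` around a point `A` with coordinates in an algebra
`Λ`, as a polynomial in the new variables `y` over `Λ`. -/
noncomputable def MvPolynomial.expandAround {F τ Λ : Type*} [Field F] [CommRing Λ] [Algebra F Λ]
    (A : τ → Λ) : MvPolynomial τ F →ₐ[F] MvPolynomial τ Λ :=
  aeval fun i => C (A i) + X i

/-- If `p` vanishes to order `M` at `A(t)`, then the coefficient of `y ^ α` in `p(A + y)` vanishes to
order `M - |α|` at `t`. In the notation of the proof, the expansion maps the ideal of `A(t)` into
`(y) + J`, and so its `M`-th power into `(y) ^ (|α| + 1) + J ^ (M - |α|)`. -/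
theorem MvPolynomial.coeff_expandAround_mem {F σ τ : Type*} [Field F]
    (A : τ → MvPolynomial σ F) (t : σ → F) {p : MvPolynomial τ F} {M : ℕ}
    (hp : p ∈ RingHom.ker (eval fun i => eval t (A i)) ^ M) (α : τ →₀ ℕ) :
    coeff α (expandAround A p) ∈ RingHom.ker (eval t) ^ (M - α.degree) := by
  set J := RingHom.ker (eval (R := F) t) with hJ
  have hle : (RingHom.ker (eval fun i => eval t (A i))).map (expandAround A) ≤
      idealOfVars τ (MvPolynomial σ F) ⊔ J.map C := by
    refine Ideal.map_le_iff_le_comap.2 fun f hf => ?_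
    rw [Ideal.mem_comap]
    have h0 : constantCoeff (expandAround A f) = aeval A f := by
      have : (constantCoeff (R := MvPolynomial σ F) (σ := τ)).comp (expandAround (F := F) A).toRingHom =
          (aeval A : MvPolynomial τ F →ₐ[F] MvPolynomial σ F).toRingHom := by
        ext i <;> simp [expandAround, algebraMap_apply]
      exact RingHom.congr_fun this f
    have h1 : aeval A f ∈ J := by
      have : (eval t).comp (aeval A : MvPolynomial τ F →ₐ[F] MvPolynomial σ F).toRingHom =
          eval fun i => eval t (A i) := by
        ext i <;> simp [algebraMap_eq]
      rw [hJ, RingHom.mem_ker]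
      exact (RingHom.congr_fun this f).trans ((RingHom.mem_ker).1 hf)
    rw [← sub_add_cancel (expandAround A f) (C (aeval A f))]
    refine add_mem (Ideal.mem_sup_left ?_) (Ideal.mem_sup_right (Ideal.mem_map_of_mem _ h1))
    rw [← pow_one (idealOfVars τ _), mem_pow_idealOfVars_iff']
    intro x hx
    obtain rfl : x = 0 := (Finsupp.degree_eq_zero_iff x).1 (by lia)
    rw [coeff_sub, ← constantCoeff_eq, h0, constantCoeff_C, sub_self]
  rcases le_or_gt M α.degree with h | h
  · simp [Nat.sub_eq_zero_of_le h]
  have h1 := Ideal.mem_map_of_mem (expandAround A) hp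
  rw [Ideal.map_pow] at h1
  have h2 := Ideal.sup_pow_le_pow_sup_pow _ _ (n := α.degree + 1) (m := M - α.degree) (by lia)
    (Ideal.pow_right_mono hle M h1)
  obtain ⟨u, hu, v, hv, huv⟩ := Submodule.mem_sup.1 h2
  rw [← huv, coeff_add, (mem_pow_idealOfVars_iff' _ _).1 hu α (by lia), zero_add]
  rw [← Ideal.map_pow, mem_map_C_iff] at hv
  exact hv α

/-- A polynomial in variables `y` whose coefficients are polynomials in variables `t` has weighted
degree at most `D`, for the weight `ℓ` on each `y` and the weight `1` on each `t`. -/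
def MvPolynomial.BidegreeLE {F σ τ : Type*} [Field F] (ℓ D : ℕ)
    (f : MvPolynomial τ (MvPolynomial σ F)) : Prop :=
  ∀ α, ∀ β ∈ (coeff α f).support, β.degree + ℓ * α.degree ≤ D

namespace MvPolynomial.BidegreeLE

variable {F σ τ : Type*} [Field F] {ℓ D D' : ℕ} {f g : MvPolynomial τ (MvPolynomial σ F)}

theorem mono (hf : BidegreeLE ℓ D f) (h : D ≤ D') : BidegreeLE ℓ D' f :=
  fun α β hβ => (hf α β hβ).trans h

theorem add (hf : BidegreeLE ℓ D f) (hg : BidegreeLE ℓ D g) : BidegreeLE ℓ D (f + g) := by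
  classical
  intro α β hβ
  rcases Finset.mem_union.1 (support_add (coeff_add α f g ▸ hβ)) with h | h
  exacts [hf α β h, hg α β h]

theorem sum {ι : Type*} {s : Finset ι} {f : ι → MvPolynomial τ (MvPolynomial σ F)}
    (hf : ∀ i ∈ s, BidegreeLE ℓ D (f i)) : BidegreeLE ℓ D (∑ i ∈ s, f i) :=
  Finset.sum_induction f (BidegreeLE ℓ D) (fun _ _ => add) (by simp [BidegreeLE]) hf

theorem mul (hf : BidegreeLE ℓ D f) (hg : BidegreeLE ℓ D' g) : BidegreeLE ℓ (D + D') (f * g) := by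
  classical
  intro α β hβ
  rw [coeff_mul] at hβ
  obtain ⟨x, hx, hβx⟩ := Finset.mem_biUnion.1 (support_sum hβ)
  obtain ⟨b, hb, c, hc, rfl⟩ := Finset.mem_add.1 (support_mul _ _ hβx)
  obtain rfl := Finset.HasAntidiagonal.mem_antidiagonal.1 hx
  have h1 := hf _ _ hb
  have h2 := hg _ _ hc
  simp only [map_add, mul_add]
  lia

theorem C {c : MvPolynomial σ F} (hc : c.totalDegree ≤ D) :
    BidegreeLE ℓ D (MvPolynomial.C c : MvPolynomial τ (MvPolynomial σ F)) := by
  classical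
  intro α β hβ
  rw [coeff_C] at hβ
  split_ifs at hβ with h
  · subst h
    rw [map_zero, mul_zero, add_zero]
    exact (le_totalDegree hβ).trans hc
  · simp at hβ

theorem X (i : τ) : BidegreeLE ℓ ℓ (X i : MvPolynomial τ (MvPolynomial σ F)) := by
  classical
  intro α β hβ
  rw [coeff_X] at hβ
  split_ifs at hβ with h
  · subst h
    rw [support_one, Finset.mem_singleton] at hβ
    simp [hβ]
  · simp at hβ

theorem one : BidegreeLE ℓ 0 (1 : MvPolynomial τ (MvPolynomial σ F)) := by
  simpa using C (τ := τ) (ℓ := ℓ) (totalDegree_one (R := F) (σ := σ)).le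

theorem pow (hf : BidegreeLE ℓ D f) (n : ℕ) : BidegreeLE ℓ (n * D) (f ^ n) := by
  induction n with
  | zero => simpa using one
  | succ n ih => simpa [pow_succ, add_mul] using ih.mul hf

theorem prod {ι : Type*} {s : Finset ι} {f : ι → MvPolynomial τ (MvPolynomial σ F)} {D : ι → ℕ}
    (hf : ∀ i ∈ s, BidegreeLE ℓ (D i) (f i)) : BidegreeLE ℓ (∑ i ∈ s, D i) (∏ i ∈ s, f i) := by
  classical
  induction s using Finset.induction_on with
  | empty => simpa using one
  | insert i s his ih =>
    rw [Finset.prod_insert his, Finset.sum_insert his]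
    exact (hf i (Finset.mem_insert_self _ _)).mul
      (ih fun j hj => hf j (Finset.mem_insert_of_mem hj))

theorem expandAround {A : τ → MvPolynomial σ F} (hA : ∀ i, (A i).totalDegree ≤ ℓ) {d : ℕ}
    {p : MvPolynomial τ F} (hp : ∀ β ∈ p.support, β.degree ≤ d) :
    BidegreeLE ℓ (d * ℓ) (MvPolynomial.expandAround A p) := by
  rw [MvPolynomial.expandAround, aeval_def, eval₂_eq]
  refine sum fun β hβ => ?_
  have h1 : BidegreeLE ℓ (∑ i ∈ β.support, β i * ℓ)
      (∏ i ∈ β.support, (MvPolynomial.C (A i) + MvPolynomial.X i) ^ β i) :=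
    prod fun i _ => ((C (hA i)).add (X i)).pow _
  rw [← Finset.sum_mul, ← Finsupp.degree_apply] at h1
  have h2 : BidegreeLE ℓ 0 (algebraMap F (MvPolynomial τ (MvPolynomial σ F)) (coeff β p)) := by
    rw [MvPolynomial.algebraMap_apply, MvPolynomial.algebraMap_eq]
    exact C (totalDegree_C _).le
  refine (h2.mul h1).mono ?_
  rw [zero_add]
  exact Nat.mul_le_mul_right _ (hp β hβ)

end MvPolynomial.BidegreeLE

/-- If `p` has degree at most `d`, and vanishes to order `M` at all points `A(t)` with `t ∈ F ^ m`,
then it vanishes to order `k` at the generic point `A`, provided that the degree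
`ℓ (d - w)` of the coefficients of order `w` is less than `(M - w) q` for all `w < k`. -/
theorem MvPolynomial.expandAround_mem_idealOfVars_pow {F τ : Type*} [Field F] [Fintype F] {m : ℕ}
    {A : τ → MvPolynomial (Fin m) F} {ℓ d M k : ℕ} (hA : ∀ i, (A i).totalDegree ≤ ℓ)
    {p : MvPolynomial τ F} (hd : ∀ β ∈ p.support, β.degree ≤ d)
    (hp : ∀ t, p ∈ RingHom.ker (eval fun i => eval t (A i)) ^ M)
    (hk : ∀ w < k, d * ℓ < (M - w) * Fintype.card F + ℓ * w) :
    expandAround A p ∈ idealOfVars τ (MvPolynomial (Fin m) F) ^ k := by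
  rw [mem_pow_idealOfVars_iff']
  intro α hα
  by_contra h0
  refine h0 (eq_zero_of_forall_mem_ker_eval_pow _ (M - α.degree)
    (fun t => coeff_expandAround_mem A t (hp t) α) ?_)
  obtain ⟨β, hβ, hβ'⟩ := Finset.exists_mem_eq_sup _ (support_nonempty.2 h0) Finsupp.degree
  change totalDegree _ = _ at hβ'
  rw [hβ']
  have := BidegreeLE.expandAround hA hd α β hβ
  have := hk _ hα
  lia

/-! ### Leading terms of substitutions -/

theorem Polynomial.natDegree_prod_pow_le_and_coeff {ι R : Type*} [CommRing R] (s : Finset ι)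
    {B : ι → Polynomial R} {w : ι → ℕ} (hB : ∀ i, (B i).natDegree ≤ w i) (β : ι → ℕ) :
    (∏ i ∈ s, B i ^ β i).natDegree ≤ ∑ i ∈ s, β i * w i ∧
      (∏ i ∈ s, B i ^ β i).coeff (∑ i ∈ s, β i * w i) = ∏ i ∈ s, (B i).coeff (w i) ^ β i := by
  classical
  induction s using Finset.induction_on with
  | empty => simp
  | insert i s his ih =>
    rw [Finset.prod_insert his, Finset.sum_insert his, Finset.prod_insert his]
    have h := Polynomial.natDegree_pow_le_of_le (β i) (hB i)
    exact ⟨Polynomial.natDegree_mul_le_of_le h ih.1, by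
      rw [Polynomial.coeff_mul_add_eq_of_natDegree_le h ih.1, ih.2,
        Polynomial.coeff_pow_of_natDegree_le (hB i)]⟩

theorem MvPolynomial.natDegree_aeval_le {F σ R : Type*} [Field F] [CommRing R] [Algebra F R]
    {B : σ → Polynomial R} {w : σ → ℕ} (hB : ∀ i, (B i).natDegree ≤ w i) {E : ℕ}
    {p : MvPolynomial σ F} (hp : ∀ β ∈ p.support, Finsupp.weight w β ≤ E) :
    (aeval B p).natDegree ≤ E := by
  rw [aeval_def, eval₂_eq]
  refine Polynomial.natDegree_sum_le_of_forall_le _ _ fun β hβ => ?_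
  rw [Polynomial.algebraMap_apply]
  refine (Polynomial.natDegree_C_mul_le _ _).trans
    ((Polynomial.natDegree_prod_pow_le_and_coeff _ hB β).1.trans ?_)
  simpa [Finsupp.weight_apply, Finsupp.sum] using hp β hβ

/-- Substituting polynomials `B i` of degree at most `w i` into a polynomial of weighted degree at
most `E`, the coefficient of degree `E` comes from the terms of weight `E` and the coefficients of
degree `w i` of the `B i`. -/
theorem MvPolynomial.coeff_aeval_of_natDegree_le {F σ R : Type*} [Field F] [CommRing R]
    [Algebra F R] {B : σ → Polynomial R} {w : σ → ℕ} (hB : ∀ i, (B i).natDegree ≤ w i) {E : ℕ}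
    {p : MvPolynomial σ F} (hp : ∀ β ∈ p.support, Finsupp.weight w β ≤ E) :
    (aeval B p).coeff E =
      aeval (fun i => (B i).coeff (w i)) (weightedHomogeneousComponent w E p) := by
  classical
  rw [weightedHomogeneousComponent_apply, map_sum, Finset.sum_filter, aeval_def, eval₂_eq,
    Polynomial.finsetSum_coeff]
  refine Finset.sum_congr rfl fun β hβ => ?_
  have hw : Finsupp.weight w β = ∑ i ∈ β.support, β i * w i := by
    simp [Finsupp.weight_apply, Finsupp.sum]
  obtain ⟨h1, h2⟩ := Polynomial.natDegree_prod_pow_le_and_coeff β.support hB β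
  rw [← hw] at h1 h2
  rw [Polynomial.algebraMap_apply, Polynomial.coeff_C_mul]
  split_ifs with h
  · rw [← h, h2, aeval_monomial, Finsupp.prod]
  · rw [Polynomial.coeff_eq_zero_of_natDegree_lt (h1.trans_lt (lt_of_le_of_ne (hp β hβ) h)),
      mul_zero]

theorem MvPolynomial.coeff_aeval_X_mul_C {F σ R : Type*} [Field F] [CommRing R] [Algebra F R]
    (b : σ → R) (D : ℕ) (p : MvPolynomial σ F) :
    (aeval (fun i => Polynomial.X * Polynomial.C (b i)) p).coeff D =
      aeval b (homogeneousComponent D p) := by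
  classical
  rw [homogeneousComponent_apply, map_sum, Finset.sum_filter, aeval_def, eval₂_eq,
    Polynomial.finsetSum_coeff]
  refine Finset.sum_congr rfl fun β hβ => ?_
  have : ∏ i ∈ β.support, (Polynomial.X * Polynomial.C (b i)) ^ β i =
      Polynomial.C (∏ i ∈ β.support, b i ^ β i) * Polynomial.X ^ β.degree := by
    simp only [mul_pow, Finset.prod_mul_distrib, Finset.prod_pow_eq_pow_sum, map_prod, map_pow]
    rw [mul_comm, Finsupp.degree_apply]
  rw [this, Polynomial.algebraMap_apply, Polynomial.coeff_C_mul, Polynomial.coeff_C_mul,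
    Polynomial.coeff_X_pow, aeval_monomial, Finsupp.prod]
  by_cases h : β.degree = D
  · simp [h]
  · simp [h, Ne.symm h]

/-- If all monomials of `p` have the same exponent `e` in the last variable, then `p(t, g(t))` is
`g ^ e` times a polynomial with the same coefficients as `p`. -/
theorem MvPolynomial.eq_zero_of_aeval_snoc_X_eq_zero {F : Type*} [Field F] {m : ℕ}
    {g : MvPolynomial (Fin m) F} (hg : g ≠ 0) {p : MvPolynomial (Fin (m + 1)) F} {e : ℕ}
    (hp : ∀ β ∈ p.support, β (Fin.last m) = e)
    (h : aeval (Fin.snoc X g : Fin (m + 1) → MvPolynomial (Fin m) F) p = 0) : p = 0 := by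
  classical
  let r (β : Fin (m + 1) →₀ ℕ) : Fin m →₀ ℕ :=
    Finsupp.equivFunOnFinite.symm fun i => β i.castSucc
  have h1 : (∑ β ∈ p.support, monomial (r β) (coeff β p)) * g ^ e = 0 := by
    rw [← h, aeval_def, eval₂_eq', Finset.sum_mul]
    refine Finset.sum_congr rfl fun β hβ => ?_
    rw [Fin.prod_univ_castSucc, monomial_eq, Finsupp.prod_fintype _ _ (by simp)]
    simp [r, hp β hβ, mul_assoc, algebraMap_eq]
  have h2 := (mul_eq_zero.1 h1).resolve_right (pow_ne_zero _ hg)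
  by_contra hp0
  obtain ⟨β, hβ⟩ := support_nonempty.2 hp0
  have h3 := congrArg (coeff (r β)) h2
  rw [coeff_sum, Finset.sum_eq_single β] at h3
  · simp at h3
    exact mem_support_iff.1 hβ h3
  · intro γ hγ hne
    rw [coeff_monomial, if_neg]
    intro hr
    refine hne (Finsupp.ext fun i => ?_)
    induction i using Fin.lastCases with
    | last => rw [hp γ hγ, hp β hβ]
    | cast i => exact DFunLike.congr_fun hr i
  · exact fun hn => (hn hβ).elim

theorem Finsupp.weight_snoc_one {m : ℕ} (ℓ : ℕ) (β : Fin (m + 1) →₀ ℕ) :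
    Finsupp.weight (Fin.snoc (fun _ => 1) ℓ : Fin (m + 1) → ℕ) β + β (Fin.last m) =
      β.degree + ℓ * β (Fin.last m) := by
  rw [Finsupp.weight_apply, Finsupp.sum_fintype _ _ (by simp), Finsupp.degree_eq_sum,
    Fin.sum_univ_castSucc, Fin.sum_univ_castSucc]
  simp
  ring

/-- For `ℓ ≥ 2`, a polynomial `p` that is homogeneous for the weights `(1, …, 1, ℓ)` is determined by
`p(R t, R g(t))`: the degree in `R` of a monomial `β` is `|β|`, and its weight is
`|β| + (ℓ - 1) β_n`. -/
theorem MvPolynomial.IsWeightedHomogeneous.eq_zero_of_aeval_X_mul_C_snoc {F : Type*} [Field F]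
    {m ℓ E : ℕ} (hl : 2 ≤ ℓ) {g : MvPolynomial (Fin m) F} (hg : g ≠ 0)
    {p : MvPolynomial (Fin (m + 1)) F}
    (hp : IsWeightedHomogeneous (Fin.snoc (fun _ => 1) ℓ : Fin (m + 1) → ℕ) p E)
    (h : aeval (fun i => Polynomial.X *
      Polynomial.C ((Fin.snoc X g : Fin (m + 1) → MvPolynomial (Fin m) F) i)) p = 0) : p = 0 := by
  by_contra hp0
  obtain ⟨β, hβ⟩ := support_nonempty.2 hp0
  have hz : homogeneousComponent β.degree p = 0 := by
    refine eq_zero_of_aeval_snoc_X_eq_zero hg (e := β (Fin.last m)) (fun γ hγ => ?_) ?_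
    · rw [mem_support_iff, coeff_homogeneousComponent, ne_eq, ite_eq_right_iff,
        Classical.not_imp] at hγ
      have h1 := Finsupp.weight_snoc_one ℓ γ
      have h2 := Finsupp.weight_snoc_one ℓ β
      rw [hp hγ.2] at h1
      rw [hp (mem_support_iff.1 hβ)] at h2
      rw [hγ.1] at h1
      obtain ⟨l, rfl⟩ := Nat.exists_eq_add_of_le hl
      have h3 : (1 + l) * γ (Fin.last m) = (1 + l) * β (Fin.last m) := by lia
      exact Nat.eq_of_mul_eq_mul_left (by lia) h3
    · rw [← coeff_aeval_X_mul_C, h, Polynomial.coeff_zero]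
  have := congrArg (coeff β) hz
  rw [coeff_homogeneousComponent, if_pos rfl, coeff_zero] at this
  exact mem_support_iff.1 hβ this

theorem MvPolynomial.pow_dvd_map_of_mem_idealOfVars_pow {σ R B : Type*} [CommRing R] [CommRing B]
    (φ : MvPolynomial σ R →+* B) {b : B} (hb : ∀ i, b ∣ φ (X i)) {k : ℕ} {f : MvPolynomial σ R}
    (hf : f ∈ idealOfVars σ R ^ k) : b ^ k ∣ φ f := by
  have h1 := Ideal.mem_map_of_mem φ hf
  rw [Ideal.map_pow] at h1
  have h2 : (idealOfVars σ R).map φ ≤ Ideal.span {b} := by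
    rw [Ideal.map_span, Ideal.span_le]
    rintro _ ⟨_, ⟨i, rfl⟩, rfl⟩
    exact Ideal.mem_span_singleton.2 (hb i)
  have h3 := Ideal.pow_right_mono h2 k h1
  rw [Ideal.span_singleton_pow] at h3
  exact Ideal.mem_span_singleton.1 h3

theorem totalDegree_eq_of_topForm_eq {F σ : Type*} [Field F] {g h : MvPolynomial σ F} {ℓ : ℕ}
    (hg : g ≠ 0) (hgl : g.IsHomogeneous ℓ) (hh : topForm h = g) : h.totalDegree = ℓ := by
  have h1 : g.IsHomogeneous h.totalDegree :=
    hh ▸ homogeneousComponent_isHomogeneous h.totalDegree h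
  exact h1.inj_right hgl hg

/-! ### Dilated graphs -/

section

variable {F : Type*} [Field F] {m : ℕ}

/-- The substitution `f(t) ↦ f(T t)`, as a polynomial in `T`. Its values lie in `F[t][R][T]`, where the
inner polynomial variable `R` is a place holder for the ratio of dilation. -/
noncomputable def scaleVars (F : Type*) [Field F] (m : ℕ) :
    MvPolynomial (Fin m) F →ₐ[F] Polynomial (Polynomial (MvPolynomial (Fin m) F)) :=
  aeval fun i => Polynomial.C (Polynomial.C (X i)) * Polynomial.X

theorem natDegree_scaleVars_le (h : MvPolynomial (Fin m) F) :
    (scaleVars F m h).natDegree ≤ h.totalDegree :=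
  natDegree_aeval_le (w := fun _ => 1)
    (fun _ => (Polynomial.natDegree_C_mul_le _ _).trans Polynomial.natDegree_X_le) fun β hβ => by
      have := le_totalDegree hβ
      rwa [← Finsupp.degree_eq_weight_one]

theorem coeff_scaleVars_totalDegree (h : MvPolynomial (Fin m) F) :
    (scaleVars F m h).coeff h.totalDegree = Polynomial.C (topForm h) := by
  rw [scaleVars, coeff_aeval_of_natDegree_le (w := fun _ => 1)
    (fun _ => (Polynomial.natDegree_C_mul_le _ _).trans Polynomial.natDegree_X_le) fun β hβ => by
      have := le_totalDegree hβ
      rwa [← Finsupp.degree_eq_weight_one]]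
  have : aeval (fun i => Polynomial.C (X i)) =
      (Polynomial.CAlgHom (R := F) (A := MvPolynomial (Fin m) F)) := by
    ext i
    simp
  simp only [Polynomial.coeff_C_mul, Polynomial.coeff_X_one, mul_one, this]
  rfl

/-- The generic point `a + ρ (t, h(t))` of the hypersurface `dilatedGraph a ρ h`. -/
noncomputable def dilatedPoint (a : Fin (m + 1) → F) (ρ : F) (h : MvPolynomial (Fin m) F) :
    Fin (m + 1) → MvPolynomial (Fin m) F :=
  fun i => C (a i) + C ρ * (Fin.snoc X h : Fin (m + 1) → MvPolynomial (Fin m) F) i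

theorem eval_dilatedPoint (a : Fin (m + 1) → F) (ρ : F) (h : MvPolynomial (Fin m) F)
    (t : Fin m → F) : (fun i => eval t (dilatedPoint a ρ h i)) ∈ dilatedGraph a ρ h := by
  refine ⟨t, funext fun i => ?_⟩
  induction i using Fin.lastCases <;> simp [dilatedPoint]

theorem totalDegree_dilatedPoint_le (a : Fin (m + 1) → F) (ρ : F) {h : MvPolynomial (Fin m) F}
    {ℓ : ℕ} (hl : 1 ≤ ℓ) (hh : h.totalDegree ≤ ℓ) (i : Fin (m + 1)) :
    (dilatedPoint a ρ h i).totalDegree ≤ ℓ := by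
  refine (totalDegree_add _ _).trans (max_le (by simp) ((totalDegree_mul _ _).trans ?_))
  induction i using Fin.lastCases <;> simp [hh, hl]

/-- The substitution `t ↦ T t` and `y ↦ (R - ρ) (T t, T ^ ℓ g(t))`, from `F[t][y]` to `F[t][R][T]`. The
exponent of `T` records the weighted degree, for the weights `(1, …, 1, ℓ)`. -/
noncomputable def weightedSubst (ρ : F) (g : MvPolynomial (Fin m) F) (ℓ : ℕ) :
    MvPolynomial (Fin (m + 1)) (MvPolynomial (Fin m) F) →+*
      Polynomial (Polynomial (MvPolynomial (Fin m) F)) :=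
  eval₂Hom (scaleVars F m : MvPolynomial (Fin m) F →+* _) fun i =>
    Polynomial.C (Polynomial.X - Polynomial.C (algebraMap F _ ρ)) *
      (Polynomial.C (Polynomial.C ((Fin.snoc X g : Fin (m + 1) → MvPolynomial (Fin m) F) i)) *
        Polynomial.X ^ (Fin.snoc (fun _ => 1) ℓ : Fin (m + 1) → ℕ) i)

theorem dvd_weightedSubst (ρ : F) (g : MvPolynomial (Fin m) F) (ℓ k : ℕ)
    {f : MvPolynomial (Fin (m + 1)) (MvPolynomial (Fin m) F)}
    (hf : f ∈ idealOfVars (Fin (m + 1)) (MvPolynomial (Fin m) F) ^ k) :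
    Polynomial.C ((Polynomial.X - Polynomial.C (algebraMap F (MvPolynomial (Fin m) F) ρ)) ^ k) ∣
      weightedSubst ρ g ℓ f := by
  rw [map_pow]
  have hX (i : Fin (m + 1)) : Polynomial.C (Polynomial.X - Polynomial.C (algebraMap F _ ρ)) ∣
      weightedSubst ρ g ℓ (X i) := by
    simp [weightedSubst]
  exact pow_dvd_map_of_mem_idealOfVars_pow (R := MvPolynomial (Fin m) F)
    (B := Polynomial (Polynomial (MvPolynomial (Fin m) F))) (weightedSubst ρ g ℓ) hX hf

/-- Let `Q` be the part of weight `E` of `p`, where `E` bounds the weights of the monomials of `p`.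
After the substitution `weightedSubst`, the coefficient of `T ^ E` in the expansion of `p` around
the generic point of `dilatedGraph a ρ h` is `Q(R t, R g(t))`, where `g` is the leading form of `h`.
This does not depend on `ρ`, on `a`, or on the lower terms of `h`. -/
theorem coeff_weightedSubst_expandAround (a : Fin (m + 1) → F) (ρ : F)
    {h : MvPolynomial (Fin m) F} (hl : 1 ≤ h.totalDegree) {E : ℕ}
    {p : MvPolynomial (Fin (m + 1)) F}
    (hp : ∀ β ∈ p.support,
      Finsupp.weight (Fin.snoc (fun _ => 1) h.totalDegree : Fin (m + 1) → ℕ) β ≤ E) :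
    (weightedSubst ρ (topForm h) h.totalDegree (expandAround (dilatedPoint a ρ h) p)).coeff E =
      aeval (fun i => Polynomial.X *
          Polynomial.C ((Fin.snoc X (topForm h) : Fin (m + 1) → MvPolynomial (Fin m) F) i))
        (weightedHomogeneousComponent
          (Fin.snoc (fun _ => 1) h.totalDegree : Fin (m + 1) → ℕ) E p) := by
  set w : Fin (m + 1) → ℕ := Fin.snoc (fun _ => 1) h.totalDegree
  let u (i : Fin (m + 1)) : Polynomial (Polynomial (MvPolynomial (Fin m) F)) :=
    scaleVars F m ((Fin.snoc X h : Fin (m + 1) → MvPolynomial (Fin m) F) i)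
  let v (i : Fin (m + 1)) : MvPolynomial (Fin m) F :=
    (Fin.snoc X (topForm h) : Fin (m + 1) → MvPolynomial (Fin m) F) i
  have hu (i) : (u i).natDegree ≤ w i ∧ (u i).coeff (w i) = Polynomial.C (v i) := by
    induction i using Fin.lastCases with
    | last =>
      simp only [u, v, w, Fin.snoc_last]
      exact ⟨natDegree_scaleVars_le h, coeff_scaleVars_totalDegree h⟩
    | cast i =>
      simp only [u, v, w, Fin.snoc_castSucc, scaleVars, aeval_X]
      exact ⟨(Polynomial.natDegree_C_mul_le _ _).trans Polynomial.natDegree_X_le, by simp⟩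
  have hw0 (i) : w i ≠ 0 := by
    induction i using Fin.lastCases <;> simp [w]
    lia
  -- the image of the coordinate `i`; its coefficient of degree `w i` is `ρ v + (R - ρ) v = R v`
  let B (i : Fin (m + 1)) : Polynomial (Polynomial (MvPolynomial (Fin m) F)) :=
    algebraMap F _ (a i) + Polynomial.C (algebraMap F _ ρ) * u i +
      Polynomial.C (Polynomial.X - Polynomial.C (algebraMap F _ ρ)) *
        (Polynomial.C (Polynomial.C (v i)) * Polynomial.X ^ w i)
  have hcomp : (weightedSubst ρ (topForm h) h.totalDegree).comp
      (expandAround (F := F) (dilatedPoint a ρ h)).toRingHom =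
        (aeval B : MvPolynomial (Fin (m + 1)) F →ₐ[F] _).toRingHom := by
    refine MvPolynomial.ringHom_ext (fun c => ?_) fun i => ?_
    · simp [expandAround, weightedSubst, MvPolynomial.algebraMap_apply, scaleVars]
    · simp [expandAround, weightedSubst, dilatedPoint, B, u, v, w, ← algebraMap_eq]
  have h1 := RingHom.congr_fun hcomp p
  replace h1 : weightedSubst ρ (topForm h) h.totalDegree (expandAround (dilatedPoint a ρ h) p) =
      aeval B p := h1
  rw [h1]
  have hB (i) : (B i).natDegree ≤ w i := by
    refine Polynomial.natDegree_add_le_of_degree_le (Polynomial.natDegree_add_le_of_degree_le ?_ ?_) ?_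
    · rw [Polynomial.algebraMap_apply, Polynomial.natDegree_C]
      exact Nat.zero_le _
    · exact (Polynomial.natDegree_C_mul_le _ _).trans (hu i).1
    · exact (Polynomial.natDegree_C_mul_le _ _).trans (Polynomial.natDegree_C_mul_X_pow_le _ _)
  refine (coeff_aeval_of_natDegree_le hB hp).trans ?_
  congr 2
  funext i
  simp only [B, Polynomial.coeff_add, Polynomial.coeff_C_mul, (hu i).2, Polynomial.coeff_X_pow_self]
  rw [Polynomial.algebraMap_apply, Polynomial.coeff_C, if_neg (hw0 i), Polynomial.algebraMap_apply]
  simp only [v]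
  ring

end

/-! ### BRK-type sets -/

/-- A polynomial of degree less than `N` that vanishes to order `M` on a BRK-type set is zero, if `M`
is large enough in terms of `N`. The auxiliary `k` is the order of vanishing at the generic points of
the hypersurfaces. -/
theorem eq_zero_of_forall_mem_ker_eval_pow_of_isBRKType {F : Type*} [Field F] [Fintype F] {m ℓ : ℕ}
    {S : Set (Fin (m + 1) → F)} (hS : IsBRKType ℓ S) {M N k : ℕ}
    (hN : N ≤ Fintype.card F * k)
    (hk : ∀ w < k, (N - 1) * ℓ < (M - w) * Fintype.card F + ℓ * w)
    {p : MvPolynomial (Fin (m + 1)) F} (hpN : ∀ β ∈ p.support, β.degree < N)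
    (hpS : ∀ s ∈ S, p ∈ RingHom.ker (eval s) ^ M) : p = 0 := by
  classical
  obtain ⟨hl, g, hg, hgl, hS⟩ := hS
  by_contra hp0
  set w : Fin (m + 1) → ℕ := Fin.snoc (fun _ => 1) ℓ with hw
  obtain ⟨β, hβ, hE⟩ :=
    Finset.exists_mem_eq_sup _ (support_nonempty.2 hp0) (Finsupp.weight w)
  set E := p.support.sup (Finsupp.weight w) with hEdef
  have hpE : ∀ γ ∈ p.support, Finsupp.weight w γ ≤ E := fun γ hγ => Finset.le_sup hγ
  -- `G = Q(R t, R g(t))` has a zero of order `k` at `R = ρ` for every `ρ ∈ F`. This includes `ρ = 0`,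
  -- where the hypersurface is a point, and the generic point is constant.
  set G : Polynomial (MvPolynomial (Fin m) F) := aeval (fun i => Polynomial.X *
    Polynomial.C ((Fin.snoc X g : Fin (m + 1) → MvPolynomial (Fin m) F) i))
    (weightedHomogeneousComponent w E p) with hG
  have hG0 : G = 0 := by
    refine Polynomial.eq_zero_of_forall_X_sub_C_pow_dvd_algebraMap (Finset.univ : Finset F) k G
      (fun ρ _ => ?_) ?_
    · obtain ⟨a, h, hh, haS⟩ := hS ρ
      have hdeg := totalDegree_eq_of_topForm_eq hg hgl hh
      have h1 : expandAround (dilatedPoint a ρ h) p ∈ idealOfVars _ _ ^ k :=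
        expandAround_mem_idealOfVars_pow
          (totalDegree_dilatedPoint_le a ρ (by lia) hdeg.le)
          (fun γ hγ => Nat.le_sub_one_of_lt (hpN γ hγ))
          (fun t => hpS _ (haS (eval_dilatedPoint a ρ h t))) hk
      have h2 := Polynomial.C_dvd_iff_dvd_coeff _ _ |>.1 (dvd_weightedSubst ρ g ℓ k h1) E
      subst hh hdeg
      rwa [coeff_weightedSubst_expandAround a ρ (by lia) hpE] at h2
    · have hN0 : 0 < N := (Nat.zero_le _).trans_lt (hpN β hβ)
      rw [Finset.card_univ]
      refine lt_of_lt_of_le (Nat.lt_of_le_pred hN0 ?_) hN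
      refine natDegree_aeval_le (w := fun _ => 1) (fun i => ?_) fun γ hγ => ?_
      · exact (Polynomial.natDegree_mul_C_le _ _).trans Polynomial.natDegree_X_le
      · rw [mem_support_iff, coeff_weightedHomogeneousComponent, ne_eq, ite_eq_right_iff,
          Classical.not_imp] at hγ
        rw [← Finsupp.degree_eq_weight_one]
        exact Nat.le_pred_of_lt (hpN γ (mem_support_iff.2 hγ.2))
  have h0 := (weightedHomogeneousComponent_isWeightedHomogeneous (w := w) E
    p).eq_zero_of_aeval_X_mul_C_snoc hl hg hG0
  have := congrArg (coeff β) h0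
  rw [coeff_weightedHomogeneousComponent, if_pos hE.symm, coeff_zero] at this
  exact mem_support_iff.1 hβ this

theorem mul_pow_le_ncard_mul_pow_of_isBRKType {F : Type*} [Field F] [Fintype F] {m ℓ : ℕ}
    (hlq : ℓ < Fintype.card F) {S : Set (Fin (m + 1) → F)} (hS : IsBRKType ℓ S) :
    (Fintype.card F * (Fintype.card F - 1)) ^ (m + 1) ≤
      S.ncard * ((ℓ + 1) * Fintype.card F - 2 * ℓ) ^ (m + 1) := by
  refine pow_le_mul_pow_of_forall_choose_le fun j hj => ?_
  by_contra! hlt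
  obtain ⟨p, hp0, hpN, hpS⟩ := exists_ne_zero_forall_mem_ker_eval_pow S S.toFinite _ _ hlt
  refine hp0 (eq_zero_of_forall_mem_ker_eval_pow_of_isBRKType hS (k := Fintype.card F * j)
    ?_ (fun w hw => ?_) hpN hpS)
  · rw [mul_comm j, mul_assoc]
    gcongr
    exact Nat.sub_le _ _
  obtain ⟨r, hr⟩ := Nat.exists_eq_add_of_lt hlq
  have hl := hS.1
  have h1 : Fintype.card F - 1 = ℓ + r := by lia
  have h2 : (ℓ + 1) * Fintype.card F - 2 * ℓ = ℓ * (Fintype.card F - 1) + r + 1 := by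
    rw [h1, hr, Nat.sub_eq_iff_eq_add (by nlinarith)]
    ring
  -- With `q = ℓ + r + 1`, the claim reduces to `w (r + 1) < q j (r + 1)`.
  rw [h2]
  set q := Fintype.card F
  have h3 : j * (ℓ * (q - 1) + r + 1) * q ≤ (j * (ℓ * (q - 1) + r + 1) - w) * q + w * q := by
    rw [← add_mul]
    exact Nat.mul_le_mul_right _ le_tsub_add
  have h4 : w * (r + 1) < q * j * (r + 1) := Nat.mul_lt_mul_of_pos_right hw (Nat.succ_pos r)
  have h5 : (j * (q * (q - 1)) - 1) * ℓ ≤ j * (q * (q - 1)) * ℓ :=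
    Nat.mul_le_mul_right _ (Nat.sub_le _ _)
  have h6 : w * q = ℓ * w + w * (r + 1) := by
    rw [hr]
    ring
  have h7 : j * (ℓ * (q - 1) + r + 1) * q = j * (q * (q - 1)) * ℓ + q * j * (r + 1) := by ring
  lia

theorem theorem1 {F : Type*} [Field F] [Finite F] (q : ℕ) (hq : Nat.card F = q)
    (m : ℕ) (ℓ : ℕ) (hl : 2 ≤ ℓ) (hlq : ℓ < q)
    (S : Set (Fin (m + 1) → F)) (hS : IsBRKType ℓ S) :
    (S.ncard : ℝ) ≥
      ((q : ℝ) - 1) ^ (m + 1) / ((ℓ : ℝ) + 1 - 2 * (ℓ : ℝ) / (q : ℝ)) ^ (m + 1) := by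
  have := Fintype.ofFinite F
  rw [Nat.card_eq_fintype_card] at hq
  subst hq
  have h := mul_pow_le_ncard_mul_pow_of_isBRKType hlq hS
  set q := Fintype.card F
  have hq0 : (0 : ℝ) < q := by exact_mod_cast (by lia : 0 < q)
  have hlq' : (ℓ : ℝ) + 1 ≤ q := by exact_mod_cast hlq
  have hl' : (2 : ℝ) ≤ ℓ := by exact_mod_cast hl
  have hc : (((ℓ + 1) * q - 2 * ℓ : ℕ) : ℝ) = q * (ℓ + 1 - 2 * ℓ / q) := by
    rw [Nat.cast_sub (by nlinarith)]
    push_cast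
    field_simp
  have hA : ((q * (q - 1) : ℕ) : ℝ) = q * (q - 1) := by
    rw [Nat.cast_mul, Nat.cast_sub (by lia), Nat.cast_one]
  have h' : ((q : ℝ) * (q - 1)) ^ (m + 1) ≤ S.ncard * (q * (ℓ + 1 - 2 * ℓ / q)) ^ (m + 1) := by
    rw [← hc, ← hA]
    exact_mod_cast h
  have hpos : (0 : ℝ) < ℓ + 1 - 2 * ℓ / q := by
    rw [sub_pos, div_lt_iff₀ hq0]
    nlinarith
  rw [ge_iff_le, div_le_iff₀ (by positivity)]
  rw [mul_pow, mul_pow, mul_left_comm] at h'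
  exact le_of_mul_le_mul_left h' (by positivity)
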